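/- Let $F_4$ be the field with four elements, $n\ge 1$, let $g_1,g_2\in F_4[x]$ divide $x^n-1$, and let $\nu\in F_4[x]$ have degree less than $n$. For $p\in F_4[x]$ let $[p]\in F_4^n$ be the vector of coefficients of $p \bmod (x^n-1)$. For polynomials $f_1,f_2,\mu$ let $\mathcal C(f_1,f_2,\mu)\subseteq F_4^{2n}$ be the quasi-cyclic code spanned by all words $([a\mu f_1],[af_1])$ and $([bf_2],[b\mu f_2])$ with $a,b\in F_4[x]$. Put $\bar\nu=\sum_{i=0}^{n-1}\nu_i^2x^{n-i}$ and $g_j^{\perp_h}=\sum_i h_{j,i}^2x^{\deg h_j-i}$, where $h_j=(x^n-1)/g_j=\sum_i h_{j,i}x^i$. Suppose that $\mathcal C=\mathcal C(g_1,g_2,\nu)$ has dimension $2n-\deg g_1-\deg g_2$ and $\mathcal C(g_1^{\perp_h},g_2^{\perp_h},-\bar\nu)$ has dimension $\deg g_1+\deg g_2$, or that $\gcd(\nu-1,x^n-1)=1$. Suppose further that $$g_1\mid(\nu\bar\nu+1)\,g_1^{\perp_h},\qquad g_2\mid(\nu\bar\nu+1)\,g_2^{\perp_h},\qquad g_2\mid(\nu+\bar\nu)\,g_1^{\perp_h}.$$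 (The first two conditions hold in particular if $g_1\mid g_1^{\perp_h}$ and $g_2\mid g_2^{\perp_h}$.) Then $2\deg g_1+2\deg g_2\le 2n$, the code $\mathcal C$ is nonzero, and, with $d$ the minimum Hamming weight of a nonzero word of $\mathcal C$, there is a binary quantum code $[[2n,\,2n-2\deg g_1-2\deg g_2,\,d]]$ that is pure to $d$. That is, there is a subspace $Q$ of $(\mathbb C^2)^{\otimes 2n}$ of dimension $2^{2n-2\deg g_1-2\deg g_2}$ such that every Pauli error of weight less than $d$ is detected by $Q$ and every Pauli error $E$ of weight $1,\dots,d-1$ satisfies $\langle\varphi,E\psi\rangle=0$ for all $\varphi,\psi\in Q$; moreover, $\langle\varphi,E\psi\rangle\neq0$ for some Pauli error $E$ of weight $d$ and some $\varphi,\psi\in Q$. -/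

import Mathlib

open Polynomial

noncomputable section

/-- The vector `[p]` of the coefficients, in ascending order, of the representative of degree `< n`
of the class of `p` in `F[X] / (X ^ n - 1)`. -/
def coeffVec {F : Type*} [Field F] (n : ℕ) (p : F[X]) : Fin n → F :=
  fun i => (p % (X ^ n - 1)).coeff i

/-- The word `([p], [q])` of length `2n`; the coordinates are indexed by two blocks of size `n`. -/
def word {F : Type*} [Field F] (n : ℕ) (p q : F[X]) : Fin n ⊕ Fin n → F :=
  Sum.elim (coeffVec n p) (coeffVec n q)

/-- The 2-generator quasi-cyclic code of length `2n` that is generated by `([ν g₁], [g₁])` and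
`([g₂], [ν g₂])`: the linear span of the words `([a ν g₁], [a g₁])` and `([b g₂], [b ν g₂])`. -/
def qcCode {F : Type*} [Field F] (n : ℕ) (g₁ g₂ ν : F[X]) : Submodule F (Fin n ⊕ Fin n → F) :=
  Submodule.span F
    (Set.range (fun a : F[X] => word n (a * (ν * g₁)) (a * g₁)) ∪
      Set.range (fun b : F[X] => word n (b * g₂) (b * (ν * g₂))))

/-- The Hermitian dual generator `∑ i, h_i² X ^ (deg h - i)`, the conjugate reciprocal polynomial of
the check polynomial `h = (X ^ n - 1) / g`. -/
def hermPerp {F : Type*} [Field F] (n : ℕ) (g : F[X]) : F[X] :=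
  ∑ i ∈ Finset.range (((X ^ n - 1) / g).natDegree + 1),
    C (((X ^ n - 1) / g).coeff i ^ 2) * X ^ (((X ^ n - 1) / g).natDegree - i)

/-- The conjugate transpose polynomial `∑_{i < n} f_i² X ^ (n - i)`, for `f` of degree `< n`. -/
def hermBar {F : Type*} [Field F] (n : ℕ) (f : F[X]) : F[X] :=
  ∑ i ∈ Finset.range n, C (f.coeff i ^ 2) * X ^ (n - i)

/-- The state space of `N` qubits, `(ℂ²)^{⊗ N}`, in coordinates with respect to the orthonormal
computational basis, which is indexed by the bit strings of length `N`. -/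
abbrev QubitSpace (N : ℕ) : Type := EuclideanSpace ℂ (Fin N → ZMod 2)

/-- The Pauli error `X(a) Z(b)`, which maps the basis vector `|x⟩` to `(-1)^{b·x} |x + a⟩`. -/
def pauli {N : ℕ} (a b : Fin N → ZMod 2) (ψ : QubitSpace N) : QubitSpace N :=
  WithLp.toLp 2 fun y => (-1 : ℂ) ^ (b ⬝ᵥ (y - a)).val * ψ (y - a)

/-- The number of qubits on which the Pauli error `X(a) Z(b)` acts nontrivially. -/
def pauliWeight {N : ℕ} (a b : Fin N → ZMod 2) : ℕ :=
  (Finset.univ.filter fun i => a i ≠ 0 ∨ b i ≠ 0).card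

/-- `Q` detects the Pauli error `X(a) Z(b)`: its compression to `Q` is a scalar. -/
def Detects {N : ℕ} (Q : Submodule ℂ (QubitSpace N)) (a b : Fin N → ZMod 2) : Prop :=
  ∃ c : ℂ, ∀ φ ∈ Q, ∀ ψ ∈ Q, inner ℂ φ (pauli a b ψ) = c * inner ℂ φ ψ

/-- `Q` is pure to `t`: the compression to `Q` of each Pauli error of weight `1, …, t - 1` is zero,
so that these errors map `Q` into its orthogonal complement. -/
def IsPureTo {N : ℕ} (Q : Submodule ℂ (QubitSpace N)) (t : ℕ) : Prop :=
  ∀ a b : Fin N → ZMod 2, 0 < pauliWeight a b → pauliWeight a b < t →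
    ∀ φ ∈ Q, ∀ ψ ∈ Q, inner ℂ φ (pauli a b ψ) = 0

/-- `Q` is an `[[N, k, d]]` quantum code that is pure to `d`: it has dimension `2 ^ k`, it detects
all errors on fewer than `d` qubits, and `d` is the largest number to which it is pure. -/
structure IsPureQuantumCode {N : ℕ} (Q : Submodule ℂ (QubitSpace N)) (k d : ℕ) : Prop where
  finrank_eq : Module.finrank ℂ Q = 2 ^ k
  detects : ∀ a b : Fin N → ZMod 2, pauliWeight a b < d → Detects Q a b
  pure : IsPureTo Q d
  not_pure : ¬ IsPureTo Q (d + 1)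

end

/-!
The module `{(u, v) | g₁ ∣ v - ν u, g₂ ∣ u - ν v}` over `F[X] / (X ^ n - 1)` contains
`C = C(g₁, g₂, ν)`, and it is the Hermitian dual of `S = C(g₁^⊥, g₂^⊥, -ν̄)`: this is its
parity-check description, because `g_j^⊥ * p̄ = 0` if and only if `g_j ∣ p`. Membership of the
generators of `S` in this module amounts to the three divisibility conditions, so that `S` is
self-orthogonal. If the dimensions of `C` and `S` add up to `2n`, then `C` is all of the dual of
`S`; if `ν - 1` is a unit, then so is `ν ^ 2 - 1 = (ν - 1) ^ 2`, and the two congruences can be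
solved for the coefficients with respect to the generators of `C`.

A self-orthogonal code over the field with four elements defines a stabilizer code. After a
rescaling, the Pauli operators on one qubit are the quaternion units, and then their commutation
signs and the signs in their multiplication table are the two components of the Hermitian form. On
a self-orthogonal `S` both vanish, so the rescaled operators form a group, the dimension of whose
fixed space is the average of its character. An error commutes with this group exactly if it comes
from the dual of `S`; any other error maps the fixed space into its orthogonal complement.
-/

section HermitianForm

/-- The sesquilinear form `∑ j, s j * σ (t j)` on `I → A`, which for an involution `σ` is the
standard Hermitian form. -/
def hermForm {A : Type*} [CommRing A] (σ : A →+* A) (I : Type*) [Fintype I] :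
    (I → A) →ₗ[A] (I → A) →ₛₗ[σ] A :=
  LinearMap.mk₂'ₛₗ (RingHom.id A) σ (fun s t => s ⬝ᵥ (σ ∘ t))
    (fun s s' t => add_dotProduct s s' _) (fun c s t => smul_dotProduct c s _)
    (fun s t t' => by simp [dotProduct, mul_add, Finset.sum_add_distrib])
    (fun c s t => by simp [dotProduct, Finset.mul_sum, mul_left_comm])

/-- The dual of a code with respect to `hermForm`. -/
def hermDual {A : Type*} [CommRing A] (σ : A →+* A) {I : Type*} [Fintype I]
    (S : Submodule A (I → A)) : Submodule A (I → A) :=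
  S.orthogonalBilin (hermForm σ I)

lemma hermForm_apply {A : Type*} [CommRing A] (σ : A →+* A) {I : Type*} [Fintype I]
    (s t : I → A) : hermForm σ I s t = ∑ j, s j * σ (t j) := rfl

lemma mem_hermDual {A : Type*} [CommRing A] {σ : A →+* A} {I : Type*} [Fintype I]
    {S : Submodule A (I → A)} {t : I → A} :
    t ∈ hermDual σ S ↔ ∀ s ∈ S, hermForm σ I s t = 0 := Iff.rfl

lemma finrank_add_finrank_hermDual {F I : Type*} [Field F] [Fintype I] {σ : F →+* F}
    (hσ : Function.Bijective σ) (S : Submodule F (I → F)) :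
    Module.finrank F S + Module.finrank F (hermDual σ S) = Fintype.card I := by
  classical
  let D := (S.map (dotProductEquiv F I).toLinearMap).dualCoannihilator
  have mem_D (t : I → F) : σ ∘ t ∈ D ↔ t ∈ hermDual σ S := by
    simp only [D, Submodule.mem_dualCoannihilator, Submodule.mem_map, forall_exists_index, and_imp,
      forall_apply_eq_imp_iff₂]
    rfl
  let conj : (I → F) ≃+ (I → F) :=
    AddEquiv.piCongrRight fun _ => (RingEquiv.ofBijective σ hσ).toAddEquiv
  let e : hermDual σ S ≃+ D :=
    { conj.toEquiv.subtypeEquiv fun t => (mem_D t).symm with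
      map_add' := fun s t => Subtype.ext (conj.map_add s t) }
  have hrank : Module.finrank F (hermDual σ S) = Module.finrank F D :=
    congrArg Cardinal.toNat <| rank_eq_of_equiv_equiv σ e hσ fun c t =>
      Subtype.ext (funext fun j => map_mul σ c (t.1 j))
  have h := Subspace.finrank_add_finrank_dualCoannihilator_eq
    (S.map (dotProductEquiv F I).toLinearMap)
  rwa [LinearEquiv.finrank_map_eq, Module.finrank_fintype_fun_eq_card, ← hrank] at h

end HermitianForm

section CyclicRing

variable {F : Type*} [Field F]

variable (F) in
/-- The ring `F[X] / (X ^ n - 1)`, whose ideals are the cyclic codes of length `n`. -/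
abbrev CyclicRing (n : ℕ) : Type _ := AdjoinRoot (X ^ n - 1 : F[X])

variable {n : ℕ}

lemma root_pow_eq_one : AdjoinRoot.root (X ^ n - 1 : F[X]) ^ n = 1 := by
  have h := AdjoinRoot.mk_self (f := (X ^ n - 1 : F[X]))
  rwa [map_sub, map_pow, AdjoinRoot.mk_X, map_one, sub_eq_zero] at h

lemma root_pow_fin_add (i j : Fin n) :
    AdjoinRoot.root (X ^ n - 1 : F[X]) ^ ((i + j : Fin n) : ℕ) =
      AdjoinRoot.root (X ^ n - 1) ^ (i : ℕ) * AdjoinRoot.root (X ^ n - 1) ^ (j : ℕ) := by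
  rw [Fin.val_add, ← pow_eq_pow_mod _ root_pow_eq_one, pow_add]

variable [NeZero n]

lemma root_mul_root_pow_pred :
    AdjoinRoot.root (X ^ n - 1 : F[X]) * AdjoinRoot.root (X ^ n - 1) ^ (n - 1) = 1 := by
  rw [mul_pow_sub_one (NeZero.ne n), root_pow_eq_one]

lemma monic_X_pow_sub_one : (X ^ n - 1 : F[X]).Monic := by
  simpa using monic_X_pow_sub_C (1 : F) (NeZero.ne n)

variable (F n) in
/-- The basis of `F[X] / (X ^ n - 1)` that consists of the powers of the class of `X`; coordinates
with respect to it are the letters of a cyclic code. -/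
noncomputable def cyclicBasis : Module.Basis (Fin n) F (CyclicRing F n) :=
  (AdjoinRoot.powerBasis' monic_X_pow_sub_one).basis.reindex
    (finCongr (by simpa using natDegree_X_pow_sub_C (n := n) (r := (1 : F))))

lemma cyclicBasis_repr_mk (p : F[X]) (i : Fin n) :
    (cyclicBasis F n).repr (AdjoinRoot.mk _ p) i = coeffVec n p i := by
  rw [cyclicBasis, Module.Basis.repr_reindex_apply]
  refine (AdjoinRoot.powerBasisAux'_repr_apply_to_fun ..).trans ?_
  rw [AdjoinRoot.modByMonicHom_mk, modByMonic_eq_mod _ monic_X_pow_sub_one]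
  rfl

lemma cyclicBasis_apply (i : Fin n) :
    cyclicBasis F n i = AdjoinRoot.root (X ^ n - 1) ^ (i : ℕ) := by
  rw [cyclicBasis, Module.Basis.reindex_apply, PowerBasis.coe_basis]
  rfl

/-- The ring endomorphism of `F[X] / (X ^ n - 1)` that acts as `σ` on `F` and maps the class of `X`
to its inverse. -/
noncomputable def cyclicConj (σ : F →+* F) (n : ℕ) [NeZero n] :
    CyclicRing F n →+* CyclicRing F n :=
  AdjoinRoot.lift ((AdjoinRoot.of _).comp σ) (AdjoinRoot.root _ ^ (n - 1)) (by
    rw [eval₂_sub, eval₂_X_pow, eval₂_one, ← pow_mul, mul_comm, pow_mul, root_pow_eq_one, one_pow,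
      sub_self])

variable (σ : F →+* F)

lemma cyclicConj_root :
    cyclicConj σ n (AdjoinRoot.root _) = AdjoinRoot.root _ ^ (n - 1) :=
  AdjoinRoot.lift_root _

lemma cyclicConj_of (a : F) :
    cyclicConj σ n (AdjoinRoot.of _ a) = AdjoinRoot.of _ (σ a) :=
  AdjoinRoot.lift_of _

lemma cyclicConj_smul (a : F) (z : CyclicRing F n) :
    cyclicConj σ n (a • z) = σ a • cyclicConj σ n z := by
  rw [Algebra.smul_def, map_mul, AdjoinRoot.algebraMap_eq, cyclicConj_of, Algebra.smul_def,
    AdjoinRoot.algebraMap_eq]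

lemma cyclicConj_involutive {σ : F →+* F} (hσ : Function.Involutive σ) :
    Function.Involutive (cyclicConj σ n) := by
  intro z
  refine RingHom.congr_fun (f := (cyclicConj σ n).comp (cyclicConj σ n)) (g := RingHom.id _) ?_ z
  refine AdjoinRoot.ringHom_ext (RingHom.ext fun a => ?_) ?_
  · simp [cyclicConj_of, hσ a]
  · have h : AdjoinRoot.root (X ^ n - 1 : F[X]) ^ (n - 1) *
        (AdjoinRoot.root (X ^ n - 1 : F[X]) ^ (n - 1)) ^ (n - 1) = 1 := by
      rw [← mul_pow, root_mul_root_pow_pred, one_pow]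
    simp only [RingHom.comp_apply, RingHom.id_apply, cyclicConj_root, map_pow]
    linear_combination AdjoinRoot.root (X ^ n - 1 : F[X]) * h -
      (AdjoinRoot.root (X ^ n - 1 : F[X]) ^ (n - 1)) ^ (n - 1) *
        root_mul_root_pow_pred (F := F) (n := n)

lemma root_pow_mul_cyclicConj_root_pow (i j : Fin n) :
    AdjoinRoot.root (X ^ n - 1 : F[X]) ^ (i : ℕ) * cyclicConj σ n (AdjoinRoot.root _ ^ (j : ℕ)) =
      AdjoinRoot.root _ ^ ((i - j : Fin n) : ℕ) := by
  conv_lhs => rw [← sub_add_cancel i j]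
  rw [root_pow_fin_add, map_pow, cyclicConj_root, mul_assoc, ← mul_pow, root_mul_root_pow_pred,
    one_pow, mul_one]

lemma mul_cyclicConj_repr_zero (p q : CyclicRing F n) :
    (cyclicBasis F n).repr (p * cyclicConj σ n q) 0 =
      ∑ j, (cyclicBasis F n).repr p j * σ ((cyclicBasis F n).repr q j) := by
  have basis_mul (i j : Fin n) :
      cyclicBasis F n i * cyclicConj σ n (cyclicBasis F n j) = cyclicBasis F n (i - j) := by
    simp only [cyclicBasis_apply, root_pow_mul_cyclicConj_root_pow]
  conv_lhs => rw [← (cyclicBasis F n).sum_repr p, ← (cyclicBasis F n).sum_repr q]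
  simp only [map_sum, cyclicConj_smul, Finset.sum_mul_sum, smul_mul_smul_comm, basis_mul, map_smul,
    Module.Basis.repr_self, Finsupp.coe_finsetSum, Finset.sum_apply, Finsupp.smul_single,
    smul_eq_mul, mul_one, Finsupp.single_apply, sub_eq_zero, Finset.sum_ite_eq, Finset.mem_univ,
    if_true]

lemma eq_zero_of_forall_repr_mul_zero {z : CyclicRing F n}
    (h : ∀ r, (cyclicBasis F n).repr (r * z) 0 = 0) : z = 0 := by
  refine (cyclicBasis F n).ext_elem fun j => ?_
  have hj := h (cyclicConj (RingHom.id F) n (cyclicBasis F n j))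
  rw [mul_comm, mul_cyclicConj_repr_zero] at hj
  simpa [Finsupp.single_apply] using hj

end CyclicRing

section QuasiCyclicCode

variable {F : Type*} [Field F] {n : ℕ} [NeZero n]

variable (F n) in
/-- The identification of pairs of elements of `F[X] / (X ^ n - 1)` with words of length `2n`. -/
noncomputable def wordEquiv : (Fin 2 → CyclicRing F n) ≃ₗ[F] (Fin n ⊕ Fin n → F) :=
  LinearEquiv.finTwoArrow F (CyclicRing F n) ≪≫ₗ
    (cyclicBasis F n).equivFun.prodCongr (cyclicBasis F n).equivFun ≪≫ₗ
    (LinearEquiv.sumArrowLequivProdArrow (Fin n) (Fin n) F F).symm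

lemma wordEquiv_apply (x : Fin 2 → CyclicRing F n) :
    wordEquiv F n x =
      Sum.elim ((cyclicBasis F n).repr (x 0)) ((cyclicBasis F n).repr (x 1)) := rfl

lemma wordEquiv_mk (p q : F[X]) :
    wordEquiv F n ![AdjoinRoot.mk _ p, AdjoinRoot.mk _ q] = word n p q := by
  rw [wordEquiv_apply, word]
  exact congrArg₂ Sum.elim (funext (cyclicBasis_repr_mk p)) (funext (cyclicBasis_repr_mk q))

/-- The quasi-cyclic code of index two that corresponds to a submodule of the square of
`F[X] / (X ^ n - 1)`. -/
noncomputable def toCode (N : Submodule (CyclicRing F n) (Fin 2 → CyclicRing F n)) :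
    Submodule F (Fin n ⊕ Fin n → F) :=
  (N.restrictScalars F).map (wordEquiv F n).toLinearMap

lemma wordEquiv_mem_toCode {N : Submodule (CyclicRing F n) (Fin 2 → CyclicRing F n)}
    {x : Fin 2 → CyclicRing F n} : wordEquiv F n x ∈ toCode N ↔ x ∈ N :=
  (wordEquiv F n).injective.mem_set_image

lemma toCode_mono {M N : Submodule (CyclicRing F n) (Fin 2 → CyclicRing F n)} (h : M ≤ N) :
    toCode M ≤ toCode N :=
  Submodule.map_mono h

lemma finrank_toCode (N : Submodule (CyclicRing F n) (Fin 2 → CyclicRing F n)) :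
    Module.finrank F (toCode N) = Module.finrank F (N.restrictScalars F) :=
  LinearEquiv.finrank_map_eq _ _

lemma hermForm_wordEquiv (σ : F →+* F) (x y : Fin 2 → CyclicRing F n) :
    hermForm σ _ (wordEquiv F n x) (wordEquiv F n y) =
      (cyclicBasis F n).repr (hermForm (cyclicConj σ n) (Fin 2) x y) 0 := by
  simp only [hermForm_apply, Fin.sum_univ_two, map_add, Finsupp.add_apply,
    mul_cyclicConj_repr_zero, Fintype.sum_sum_type, wordEquiv_apply, Sum.elim_inl, Sum.elim_inr]

lemma hermDual_toCode (σ : F →+* F) (N : Submodule (CyclicRing F n) (Fin 2 → CyclicRing F n)) :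
    hermDual σ (toCode N) = toCode (hermDual (cyclicConj σ n) N) := by
  ext w
  obtain ⟨y, rfl⟩ := (wordEquiv F n).surjective w
  rw [wordEquiv_mem_toCode, mem_hermDual, mem_hermDual]
  constructor
  · refine fun hy x hx => eq_zero_of_forall_repr_mul_zero fun r => ?_
    rw [← smul_eq_mul, ← LinearMap.smul_apply, ← map_smul, ← hermForm_wordEquiv]
    exact hy _ (wordEquiv_mem_toCode.mpr (N.smul_mem r hx))
  · rintro hy _ ⟨x, hx, rfl⟩
    exact (hermForm_wordEquiv σ x y).trans (by simp [hy x hx])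

end QuasiCyclicCode

section QuasiCyclicModule

variable {A : Type*} [CommRing A]

/-- The module of pairs that is generated by `(ν a, a)` and `(b, ν b)`; over
`F[X] / (X ^ n - 1)` it is the two-generator quasi-cyclic code `qcCode`. -/
def qcModule (a b ν : A) : Submodule A (Fin 2 → A) :=
  Submodule.span A {![ν * a, a], ![b, ν * b]}

/-- The module of pairs `(u, v)` with `a ∣ v - ν u` and `b ∣ u - ν v`: the parity-check
description of the Hermitian dual of a two-generator quasi-cyclic code. -/
def congruenceModule (a b ν : A) : Submodule A (Fin 2 → A) :=
  Submodule.comap (LinearMap.proj 1 - ν • LinearMap.proj 0) (Ideal.span {a}) ⊓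
    Submodule.comap (LinearMap.proj 0 - ν • LinearMap.proj 1) (Ideal.span {b})

variable {a b ν : A}

lemma mem_congruenceModule {x : Fin 2 → A} :
    x ∈ congruenceModule a b ν ↔ a ∣ x 1 - ν * x 0 ∧ b ∣ x 0 - ν * x 1 :=
  and_congr Ideal.mem_span_singleton Ideal.mem_span_singleton

lemma qcModule_le_iff {k₁ k₂ μ : A} {N : Submodule A (Fin 2 → A)} :
    qcModule k₁ k₂ μ ≤ N ↔ ![μ * k₁, k₁] ∈ N ∧ ![k₂, μ * k₂] ∈ N := by
  rw [qcModule, Submodule.span_le, Set.pair_subset_iff]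
  rfl

lemma qcModule_le_congruenceModule : qcModule a b ν ≤ congruenceModule a b ν := by
  refine qcModule_le_iff.mpr ⟨mem_congruenceModule.mpr ⟨⟨1 - ν ^ 2, ?_⟩, ⟨0, ?_⟩⟩,
    mem_congruenceModule.mpr ⟨⟨0, ?_⟩, ⟨1 - ν ^ 2, ?_⟩⟩⟩ <;>
  · simp only [Matrix.cons_val_zero, Matrix.cons_val_one]
    ring

lemma congruenceModule_le_qcModule (hν : IsUnit (ν ^ 2 - 1)) :
    congruenceModule a b ν ≤ qcModule a b ν := by
  intro x hx
  obtain ⟨⟨s, hs⟩, ⟨t, ht⟩⟩ := mem_congruenceModule.mp hx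
  obtain ⟨ρ, hρ⟩ := hν.exists_left_inv
  refine Submodule.mem_span_pair.mpr ⟨-ρ * s, -ρ * t, ?_⟩
  ext i
  fin_cases i
  · simp only [Fin.zero_eta, Pi.add_apply, Pi.smul_apply, Matrix.cons_val_zero, smul_eq_mul]
    linear_combination ρ * ν * hs + ρ * ht + x 0 * hρ
  · simp only [Fin.mk_one, Pi.add_apply, Pi.smul_apply, Matrix.cons_val_one,
      Matrix.cons_val_fin_one, smul_eq_mul]
    linear_combination ρ * hs + ρ * ν * ht + x 1 * hρ

lemma finrank_congruenceModule {F : Type*} [Field F] [Algebra F A] [Module.Finite F A]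
    (hν : IsUnit (ν ^ 2 - 1)) :
    Module.finrank F ((congruenceModule a b ν).restrictScalars F) +
        (Module.finrank F (A ⧸ Ideal.span {a}) + Module.finrank F (A ⧸ Ideal.span {b})) =
      2 * Module.finrank F A := by
  let φ : (Fin 2 → A) →ₗ[A] (A ⧸ Ideal.span {a}) × (A ⧸ Ideal.span {b}) :=
    (Submodule.mkQ _ ∘ₗ (LinearMap.proj 1 - ν • LinearMap.proj 0)).prod
      (Submodule.mkQ _ ∘ₗ (LinearMap.proj 0 - ν • LinearMap.proj 1))
  have hker : LinearMap.ker φ = congruenceModule a b ν := by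
    simp only [φ, LinearMap.ker_prod, LinearMap.ker_comp, Submodule.ker_mkQ]
    rfl
  have hsurj : Function.Surjective φ := by
    rintro ⟨p, q⟩
    obtain ⟨p, rfl⟩ := Submodule.mkQ_surjective _ p
    obtain ⟨q, rfl⟩ := Submodule.mkQ_surjective _ q
    obtain ⟨ρ, hρ⟩ := hν.exists_left_inv
    refine ⟨![-ρ * (ν * p + q), -ρ * (p + ν * q)],
      Prod.ext (congrArg (Submodule.mkQ _) ?_) (congrArg (Submodule.mkQ _) ?_)⟩
    · change -ρ * (p + ν * q) - ν * (-ρ * (ν * p + q)) = p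
      linear_combination p * hρ
    · change -ρ * (ν * p + q) - ν * (-ρ * (p + ν * q)) = q
      linear_combination q * hρ
  have h := (φ.restrictScalars F).finrank_range_add_finrank_ker
  rwa [LinearMap.range_eq_top (f := φ.restrictScalars F).mpr hsurj, finrank_top,
    Module.finrank_prod, LinearMap.ker_restrictScalars, hker, Module.finrank_pi_fintype,
    Finset.sum_const, Finset.card_univ, Fintype.card_fin, smul_eq_mul, add_comm] at h

section Dual

variable {k₁ k₂ : A} {τ : A →+* A}

lemma hermDual_qcModule (hk₁ : ∀ p, k₁ * τ p = 0 ↔ a ∣ p) (hk₂ : ∀ p, k₂ * τ p = 0 ↔ b ∣ p) :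
    hermDual τ (qcModule k₁ k₂ (-τ ν)) = congruenceModule a b ν := by
  ext x
  have h : x ∈ hermDual τ (qcModule k₁ k₂ (-τ ν)) ↔
      qcModule k₁ k₂ (-τ ν) ≤ LinearMap.ker ((hermForm τ (Fin 2)).flip x) := Iff.rfl
  rw [h, qcModule_le_iff, mem_congruenceModule, ← hk₁, ← hk₂, LinearMap.mem_ker, LinearMap.mem_ker,
    LinearMap.flip_apply, LinearMap.flip_apply, hermForm_apply, hermForm_apply, Fin.sum_univ_two,
    Fin.sum_univ_two]
  simp only [Matrix.cons_val_zero, Matrix.cons_val_one, Matrix.cons_val_fin_one, map_sub, map_mul]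
  refine and_congr (Eq.congr_left ?_) (Eq.congr_left ?_) <;> ring

lemma qcModule_le_hermDual_self (hτ : Function.Involutive τ) (hk₁ : ∀ p, k₁ * τ p = 0 ↔ a ∣ p)
    (hk₂ : ∀ p, k₂ * τ p = 0 ↔ b ∣ p) (h₁ : a ∣ (ν * τ ν + 1) * k₁)
    (h₂ : b ∣ (ν * τ ν + 1) * k₂) (h₁₂ : b ∣ (ν + τ ν) * k₁) :
    qcModule k₁ k₂ (-τ ν) ≤ hermDual τ (qcModule k₁ k₂ (-τ ν)) := by
  have h₂₁ : a ∣ (ν + τ ν) * k₂ := by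
    have h := congrArg τ ((hk₂ _).mpr h₁₂)
    rw [map_mul, hτ, map_zero] at h
    rw [← hk₁, ← h, map_mul, map_add, hτ]
    ring
  rw [hermDual_qcModule hk₁ hk₂, qcModule_le_iff, mem_congruenceModule, mem_congruenceModule]
  simp only [Matrix.cons_val_zero, Matrix.cons_val_one, Matrix.cons_val_fin_one]
  refine ⟨⟨?_, ?_⟩, ?_, ?_⟩
  · convert h₁ using 1; ring
  · rw [← dvd_neg]; convert h₁₂ using 1; ring
  · rw [← dvd_neg]; convert h₂₁ using 1; ring
  · convert h₂ using 1; ring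

end Dual

end QuasiCyclicModule

section DualGenerator

variable {F : Type*} [Field F] {n : ℕ}

lemma mk_dvd_mk_iff {f g : F[X]} (hg : g ∣ f) {p : F[X]} :
    AdjoinRoot.mk f g ∣ AdjoinRoot.mk f p ↔ g ∣ p := by
  refine ⟨fun ⟨q, hq⟩ => ?_, map_dvd _⟩
  obtain ⟨q, rfl⟩ := AdjoinRoot.mk_surjective q
  rw [← map_mul, AdjoinRoot.mk_eq_mk] at hq
  exact (dvd_iff_dvd_of_dvd_sub (hg.trans hq)).mpr (dvd_mul_right g q)

lemma mk_div_mul_eq_zero_iff {f g : F[X]} (hf : f ≠ 0) (hg : g ∣ f) {z : AdjoinRoot f} :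
    AdjoinRoot.mk f (f / g) * z = 0 ↔ AdjoinRoot.mk f g ∣ z := by
  obtain ⟨p, rfl⟩ := AdjoinRoot.mk_surjective z
  have hfg := EuclideanDomain.mul_div_cancel' (ne_zero_of_dvd_ne_zero hf hg) hg
  have hne : f / g ≠ 0 := right_ne_zero_of_mul (hfg ▸ hf)
  rw [← map_mul, AdjoinRoot.mk_eq_zero, mk_dvd_mk_iff hg,
    ← mul_dvd_mul_iff_left (b := g) hne, mul_comm (f / g) g, hfg]

variable [NeZero n]

lemma root_pow_sub {m i : ℕ} (hi : i ≤ m) :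
    AdjoinRoot.root (X ^ n - 1 : F[X]) ^ (m - i) =
      AdjoinRoot.root (X ^ n - 1) ^ m * (AdjoinRoot.root (X ^ n - 1) ^ (n - 1)) ^ i := by
  conv_rhs => rw [← Nat.sub_add_cancel hi, pow_add, mul_assoc, ← mul_pow, root_mul_root_pow_pred,
    one_pow, mul_one]

variable [CharP F 2]

lemma mk_sum_sq_mul_X_pow {p : F[X]} {N m : ℕ} (hN : p.natDegree < N)
    (hm : N ≤ m + 1) :
    AdjoinRoot.mk (X ^ n - 1) (∑ i ∈ Finset.range N, C (p.coeff i ^ 2) * X ^ (m - i)) =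
      AdjoinRoot.root _ ^ m * cyclicConj (frobenius F 2) n (AdjoinRoot.mk _ p) := by
  rw [cyclicConj, AdjoinRoot.lift_mk, eval₂_eq_sum_range' _ hN, map_sum, Finset.mul_sum]
  refine Finset.sum_congr rfl fun i hi => ?_
  rw [map_mul, AdjoinRoot.mk_C, map_pow (AdjoinRoot.mk _) X, AdjoinRoot.mk_X,
    root_pow_sub (by have := Finset.mem_range.mp hi; omega), mul_left_comm]
  rfl

lemma mk_hermBar {ν : F[X]} (hν : ν.degree < n) :
    AdjoinRoot.mk (X ^ n - 1) (hermBar n ν) =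
      cyclicConj (frobenius F 2) n (AdjoinRoot.mk _ ν) := by
  have hdeg : ν.natDegree < n := by
    obtain rfl | h := eq_or_ne ν 0
    · exact natDegree_zero.trans_lt (NeZero.pos n)
    · exact (natDegree_lt_iff_degree_lt h).mpr hν
  rw [hermBar, mk_sum_sq_mul_X_pow hdeg n.le_succ, root_pow_eq_one, one_mul]

lemma mk_hermPerp (g : F[X]) :
    AdjoinRoot.mk (X ^ n - 1) (hermPerp n g) =
      AdjoinRoot.root _ ^ ((X ^ n - 1) / g).natDegree *
        cyclicConj (frobenius F 2) n (AdjoinRoot.mk _ ((X ^ n - 1) / g)) :=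
  mk_sum_sq_mul_X_pow (Nat.lt_succ_self _) le_rfl

lemma mk_hermPerp_mul_cyclicConj_eq_zero_iff
    (hF : Function.Involutive (frobenius F 2)) {g : F[X]} (hg : g ∣ X ^ n - 1)
    (z : CyclicRing F n) :
    AdjoinRoot.mk _ (hermPerp n g) * cyclicConj (frobenius F 2) n z = 0 ↔
      AdjoinRoot.mk _ g ∣ z := by
  have hroot : IsUnit (AdjoinRoot.root (X ^ n - 1 : F[X]) ^ ((X ^ n - 1) / g).natDegree) :=
    (IsUnit.of_pow_eq_one root_pow_eq_one (NeZero.ne n)).pow _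
  rw [mk_hermPerp, mul_assoc, hroot.mul_right_eq_zero, ← map_mul,
    map_eq_zero_iff _ (cyclicConj_involutive hF).injective,
    mk_div_mul_eq_zero_iff monic_X_pow_sub_one.ne_zero hg]

end DualGenerator

section QuasiCyclicParameters

variable {F : Type*} [Field F] {n : ℕ} [NeZero n]

lemma qcCode_eq_toCode (g₁ g₂ ν : F[X]) :
    qcCode n g₁ g₂ ν =
      toCode (qcModule (AdjoinRoot.mk _ g₁) (AdjoinRoot.mk _ g₂) (AdjoinRoot.mk _ ν)) := by
  have hgen₁ (a : F[X]) : word n (a * (ν * g₁)) (a * g₁) =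
      wordEquiv F n (AdjoinRoot.mk (X ^ n - 1) a • ![AdjoinRoot.mk _ ν * AdjoinRoot.mk _ g₁,
        AdjoinRoot.mk _ g₁]) := by
    rw [← wordEquiv_mk]
    simp
  have hgen₂ (b : F[X]) : word n (b * g₂) (b * (ν * g₂)) =
      wordEquiv F n (AdjoinRoot.mk (X ^ n - 1) b • ![AdjoinRoot.mk _ g₂,
        AdjoinRoot.mk _ ν * AdjoinRoot.mk _ g₂]) := by
    rw [← wordEquiv_mk]
    simp
  refine le_antisymm (Submodule.span_le.mpr (Set.union_subset ?_ ?_)) fun w hw => ?_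
  · rintro _ ⟨a, rfl⟩
    simp only [hgen₁, SetLike.mem_coe, wordEquiv_mem_toCode]
    exact Submodule.smul_mem _ _ (Submodule.subset_span (Set.mem_insert _ _))
  · rintro _ ⟨b, rfl⟩
    simp only [hgen₂, SetLike.mem_coe, wordEquiv_mem_toCode]
    exact Submodule.smul_mem _ _ (Submodule.subset_span (Set.mem_insert_of_mem _ rfl))
  · obtain ⟨x, rfl⟩ := (wordEquiv F n).surjective w
    obtain ⟨a, b, rfl⟩ := Submodule.mem_span_pair.mp (wordEquiv_mem_toCode.mp hw)
    obtain ⟨a, rfl⟩ := AdjoinRoot.mk_surjective a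
    obtain ⟨b, rfl⟩ := AdjoinRoot.mk_surjective b
    rw [map_add, ← hgen₁, ← hgen₂]
    exact add_mem (Submodule.subset_span (Or.inl ⟨a, rfl⟩))
      (Submodule.subset_span (Or.inr ⟨b, rfl⟩))

lemma finrank_cyclicRing : Module.finrank F (CyclicRing F n) = n := by
  rw [Module.finrank_eq_card_basis (cyclicBasis F n), Fintype.card_fin]

lemma finrank_quotient_span_mk {f g : F[X]} (hf : f ≠ 0) (hg : g ∣ f) :
    Module.finrank F (AdjoinRoot f ⧸ Ideal.span {AdjoinRoot.mk f g}) = g.natDegree := by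
  let φ : AdjoinRoot f →ₐ[F] AdjoinRoot g := AdjoinRoot.algHomOfDvd F f g hg
  have φ_mk (p : F[X]) : φ (AdjoinRoot.mk f p) = AdjoinRoot.mk g p := by
    rw [← AdjoinRoot.aeval_eq, ← AdjoinRoot.aeval_eq, ← aeval_algHom_apply,
      AdjoinRoot.algHomOfDvd_root]
  have hker : RingHom.ker φ = Ideal.span {AdjoinRoot.mk f g} := by
    ext z
    obtain ⟨p, rfl⟩ := AdjoinRoot.mk_surjective z
    rw [RingHom.mem_ker, φ_mk, AdjoinRoot.mk_eq_zero, Ideal.mem_span_singleton, mk_dvd_mk_iff hg]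
  have hsurj : Function.Surjective φ := fun z => by
    obtain ⟨p, rfl⟩ := AdjoinRoot.mk_surjective z
    exact ⟨_, φ_mk p⟩
  rw [← hker, (Ideal.quotientKerAlgEquivOfSurjective hsurj).toLinearEquiv.finrank_eq,
    (AdjoinRoot.powerBasis (ne_zero_of_dvd_ne_zero hf hg)).finrank, AdjoinRoot.powerBasis_dim]

variable {g₁ g₂ ν : F[X]}

lemma finrank_toCode_congruenceModule (hg₁ : g₁ ∣ X ^ n - 1) (hg₂ : g₂ ∣ X ^ n - 1)
    (hν : IsUnit ((AdjoinRoot.mk (X ^ n - 1) ν) ^ 2 - 1)) :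
    Module.finrank F (toCode (n := n) (congruenceModule (AdjoinRoot.mk _ g₁) (AdjoinRoot.mk _ g₂)
      (AdjoinRoot.mk _ ν))) + g₁.natDegree + g₂.natDegree = 2 * n := by
  have : Module.Finite F (CyclicRing F n) := .of_basis (cyclicBasis F n)
  have h := finrank_congruenceModule (F := F) (a := AdjoinRoot.mk _ g₁) (b := AdjoinRoot.mk _ g₂) hν
  rw [finrank_quotient_span_mk monic_X_pow_sub_one.ne_zero hg₁,
    finrank_quotient_span_mk monic_X_pow_sub_one.ne_zero hg₂, finrank_cyclicRing] at h
  rw [finrank_toCode, add_assoc, h]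

end QuasiCyclicParameters

section QuasiCyclicDual

variable {F : Type*} [Field F] [CharP F 2] {n : ℕ} [NeZero n] {g₁ g₂ ν : F[X]}

lemma qcCode_hermPerp_eq_toCode (hν : ν.degree < n) :
    qcCode n (hermPerp n g₁) (hermPerp n g₂) (-hermBar n ν) =
      toCode (qcModule (AdjoinRoot.mk _ (hermPerp n g₁)) (AdjoinRoot.mk _ (hermPerp n g₂))
        (-cyclicConj (frobenius F 2) n (AdjoinRoot.mk _ ν))) := by
  rw [qcCode_eq_toCode, map_neg, mk_hermBar hν]

variable (hF : Function.Involutive (frobenius F 2)) (hg₁ : g₁ ∣ X ^ n - 1) (hg₂ : g₂ ∣ X ^ n - 1)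
  (hν : ν.degree < n)

include hF hg₁ hg₂ hν

lemma hermDual_qcCode :
    hermDual (frobenius F 2) (qcCode n (hermPerp n g₁) (hermPerp n g₂) (-hermBar n ν)) =
      toCode (congruenceModule (AdjoinRoot.mk _ g₁) (AdjoinRoot.mk _ g₂) (AdjoinRoot.mk _ ν)) := by
  rw [qcCode_hermPerp_eq_toCode hν, hermDual_toCode,
    hermDual_qcModule (mk_hermPerp_mul_cyclicConj_eq_zero_iff hF hg₁)
      (mk_hermPerp_mul_cyclicConj_eq_zero_iff hF hg₂)]

lemma qcCode_le_hermDual : qcCode n g₁ g₂ ν ≤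
    hermDual (frobenius F 2) (qcCode n (hermPerp n g₁) (hermPerp n g₂) (-hermBar n ν)) := by
  rw [qcCode_eq_toCode, hermDual_qcCode hF hg₁ hg₂ hν]
  exact toCode_mono qcModule_le_congruenceModule

lemma qcCode_le_hermDual_self (h₁ : g₁ ∣ (ν * hermBar n ν + 1) * hermPerp n g₁)
    (h₂ : g₂ ∣ (ν * hermBar n ν + 1) * hermPerp n g₂)
    (h₁₂ : g₂ ∣ (ν + hermBar n ν) * hermPerp n g₁) :
    qcCode n (hermPerp n g₁) (hermPerp n g₂) (-hermBar n ν) ≤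
      hermDual (frobenius F 2) (qcCode n (hermPerp n g₁) (hermPerp n g₂) (-hermBar n ν)) := by
  rw [← mk_dvd_mk_iff hg₁] at h₁
  rw [← mk_dvd_mk_iff hg₂] at h₂ h₁₂
  simp only [map_mul, map_add, map_one, mk_hermBar hν] at h₁ h₂ h₁₂
  rw [qcCode_hermPerp_eq_toCode hν, hermDual_toCode]
  exact toCode_mono (qcModule_le_hermDual_self (cyclicConj_involutive hF)
    (mk_hermPerp_mul_cyclicConj_eq_zero_iff hF hg₁) (mk_hermPerp_mul_cyclicConj_eq_zero_iff hF hg₂)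
    h₁ h₂ h₁₂)

lemma hermDual_qcCode_eq_and_finrank_eq
    (hdim : IsCoprime (ν - 1) (X ^ n - 1) ∨
      (Module.finrank F (qcCode n g₁ g₂ ν) + g₁.natDegree + g₂.natDegree = 2 * n ∧
        Module.finrank F (qcCode n (hermPerp n g₁) (hermPerp n g₂) (-hermBar n ν)) =
          g₁.natDegree + g₂.natDegree)) :
    hermDual (frobenius F 2) (qcCode n (hermPerp n g₁) (hermPerp n g₂) (-hermBar n ν)) =
        qcCode n g₁ g₂ ν ∧
      Module.finrank F (qcCode n (hermPerp n g₁) (hermPerp n g₂) (-hermBar n ν)) =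
        g₁.natDegree + g₂.natDegree := by
  have hle := qcCode_le_hermDual hF hg₁ hg₂ hν
  have hsum := finrank_add_finrank_hermDual hF.bijective
    (qcCode n (hermPerp n g₁) (hermPerp n g₂) (-hermBar n ν))
  rw [Fintype.card_sum, Fintype.card_fin, ← two_mul] at hsum
  rcases hdim with hco | ⟨hC, hS⟩
  · have hunit : IsUnit (AdjoinRoot.mk (X ^ n - 1) ν ^ 2 - 1) := by
      have hmk := (hco.pow_left (m := 2)).map (AdjoinRoot.mk (X ^ n - 1))
      rwa [AdjoinRoot.mk_self, isCoprime_zero_right, sub_pow_expChar, one_pow, map_sub, map_pow,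
        map_one] at hmk
    have hdual := hermDual_qcCode hF hg₁ hg₂ hν
    have hrank := finrank_toCode_congruenceModule hg₁ hg₂ hunit
    rw [← hdual] at hrank
    refine ⟨le_antisymm ?_ hle, by omega⟩
    rw [hdual, qcCode_eq_toCode]
    exact toCode_mono (congruenceModule_le_qcModule hunit)
  · exact ⟨(Submodule.eq_of_le_of_finrank_eq hle (by omega)).symm, hS⟩

end QuasiCyclicDual

lemma exists_isLeast_hammingNorm {F I : Type*} [Field F] [DecidableEq F] [Fintype I]
    {C : Submodule F (I → F)} (hC : C ≠ ⊥) :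
    ∃ d, IsLeast {w : ℕ | ∃ c ∈ C, c ≠ 0 ∧ hammingNorm c = w} d := by
  obtain ⟨c, hc, hc0⟩ := Submodule.exists_mem_ne_zero_of_ne_bot hC
  exact ⟨_, isLeast_csInf ⟨_, c, hc, hc0, rfl⟩⟩

lemma zmod_two_eq_zero_or_eq_one : ∀ x : ZMod 2, x = 0 ∨ x = 1 := by decide

section Pauli

/-- The character `x ↦ (-1) ^ x` of bits, in which the commutation of Pauli errors is expressed. -/
def bitSign : AddChar (ZMod 2) ℂ := AddChar.zmodChar 2 (neg_one_sq (R := ℂ))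

lemma bitSign_apply (x : ZMod 2) : bitSign x = (-1) ^ x.val := rfl

lemma bitSign_mul_self (x : ZMod 2) : bitSign x * bitSign x = 1 := by
  rw [← AddChar.map_add_eq_mul, CharTwo.add_self_eq_zero, AddChar.map_zero_eq_one]

lemma star_bitSign (x : ZMod 2) : (starRingEnd ℂ) (bitSign x) = bitSign x := by
  simp [bitSign_apply]

lemma bitSign_of_ne_zero {x : ZMod 2} (hx : x ≠ 0) : bitSign x = -1 := by
  rw [(zmod_two_eq_zero_or_eq_one x).resolve_left hx, bitSign_apply, ZMod.val_one, pow_one]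

lemma bitSign_sum {ι : Type*} (s : Finset ι) (f : ι → ZMod 2) :
    bitSign (∑ i ∈ s, f i) = ∏ i ∈ s, bitSign (f i) :=
  map_prod bitSign.toMonoidHom (fun i => Multiplicative.ofAdd (f i)) s

variable {N : ℕ}

lemma sum_bitSign_dotProduct {b : Fin N → ZMod 2} (hb : b ≠ 0) :
    ∑ y : Fin N → ZMod 2, bitSign (b ⬝ᵥ y) = 0 := by
  obtain ⟨i, hi⟩ := Function.ne_iff.mp hb
  let χ : AddChar (Fin N → ZMod 2) ℂ :=
    bitSign.compAddMonoidHom (AddMonoidHom.mk' (b ⬝ᵥ ·) (dotProduct_add b))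
  refine (AddChar.sum_eq_zero_iff_ne_zero (ψ := χ)).mpr
    (DFunLike.ne_iff.mpr ⟨Pi.single i 1, ?_⟩)
  have hχ : χ (Pi.single i 1) = -1 := by
    simpa [χ] using bitSign_of_ne_zero hi
  rw [hχ]
  norm_num

/-- The pairs `(a, b)` that index the Pauli errors `X(a) Z(b)`; adding them corresponds to composing
the errors up to a scalar. -/
abbrev PauliIndex (N : ℕ) : Type := (Fin N → ZMod 2) × (Fin N → ZMod 2)

lemma pauli_apply (a b : Fin N → ZMod 2) (ψ : QubitSpace N) (y : Fin N → ZMod 2) :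
    pauli a b ψ y = bitSign (b ⬝ᵥ (y - a)) * ψ (y - a) := rfl

lemma pauli_zero (ψ : QubitSpace N) : pauli 0 0 ψ = ψ := by
  ext y
  simp [pauli_apply]

lemma inner_pauli_pauli (a b : Fin N → ZMod 2) (φ ψ : QubitSpace N) :
    inner ℂ (pauli a b φ) (pauli a b ψ) = inner ℂ φ ψ := by
  simp only [PiLp.inner_apply, pauli_apply]
  rw [← Equiv.sum_comp (Equiv.subRight a) fun y => inner ℂ (φ y) (ψ y)]
  refine Finset.sum_congr rfl fun y _ => ?_
  simp only [RCLike.inner_apply, map_mul, star_bitSign, Equiv.subRight_apply]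
  linear_combination (ψ (y - a) * (starRingEnd ℂ) (φ (y - a))) * bitSign_mul_self (b ⬝ᵥ (y - a))

/-- The Pauli error `X(a) Z(b)` as a linear map. -/
def pauliLin (t : PauliIndex N) : QubitSpace N →ₗ[ℂ] QubitSpace N where
  toFun := pauli t.1 t.2
  map_add' φ ψ := by ext; simp [pauli_apply, mul_add]
  map_smul' c ψ := by ext; simp [pauli_apply, mul_left_comm]

lemma pauliLin_apply (t : PauliIndex N) (ψ : QubitSpace N) :
    pauliLin t ψ = pauli t.1 t.2 ψ := rfl

lemma pauliLin_mul (s t : PauliIndex N) :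
    pauliLin s * pauliLin t = bitSign (s.2 ⬝ᵥ t.1) • pauliLin (s + t) := by
  ext ψ y
  have h : y - s.1 = y - (s.1 + t.1) + t.1 := by abel
  simp only [Module.End.mul_apply, LinearMap.smul_apply, pauliLin_apply, pauli_apply,
    PiLp.smul_apply, smul_eq_mul, sub_sub, Prod.fst_add, Prod.snd_add]
  rw [h, add_dotProduct, dotProduct_add, AddChar.map_add_eq_mul, AddChar.map_add_eq_mul]
  ring

lemma trace_pauliLin {t : PauliIndex N} (ht : t ≠ 0) :
    LinearMap.trace ℂ (QubitSpace N) (pauliLin t) = 0 := by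
  rw [LinearMap.trace_eq_sum_inner _ (EuclideanSpace.basisFun _ ℂ)]
  simp only [EuclideanSpace.basisFun_apply, EuclideanSpace.inner_single_left, map_one, one_mul,
    pauliLin_apply, pauli_apply]
  by_cases ht₁ : t.1 = 0
  · have ht₂ : t.2 ≠ 0 := fun ht₂ => ht (Prod.ext ht₁ ht₂)
    simpa [ht₁] using sum_bitSign_dotProduct ht₂
  · refine Finset.sum_eq_zero fun y _ => ?_
    have hy : y - t.1 ≠ y := by simpa using ht₁
    simp [hy]

/-- The symplectic form, with respect to which two Pauli errors are orthogonal if and only if they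
commute. -/
def sympForm (s t : PauliIndex N) : ZMod 2 := s.1 ⬝ᵥ t.2 + s.2 ⬝ᵥ t.1

lemma pauliLin_mul_comm (s t : PauliIndex N) :
    pauliLin s * pauliLin t = bitSign (sympForm s t) • (pauliLin t * pauliLin s) := by
  rw [pauliLin_mul, pauliLin_mul, smul_smul, sympForm, dotProduct_comm s.1,
    AddChar.map_add_eq_mul, mul_right_comm, bitSign_mul_self, one_mul, add_comm]

/-- The bilinear form whose sign is the cocycle of the Pauli errors, rescaled by `pauliPhase`
so that on each qubit they become the quaternion units. -/
def quatForm (s t : PauliIndex N) : ZMod 2 := s.1 ⬝ᵥ t.1 + s.2 ⬝ᵥ t.2 + s.1 ⬝ᵥ t.2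

/-- The phase that turns a Pauli error into a tensor product of quaternion units. -/
def pauliPhase (t : PauliIndex N) : ℂ := ∏ i, if t.1 i = t.2 i then 1 else Complex.I

lemma star_pauliPhase_mul_self (t : PauliIndex N) :
    (starRingEnd ℂ) (pauliPhase t) * pauliPhase t = 1 := by
  rw [pauliPhase, map_prod, ← Finset.prod_mul_distrib]
  refine Finset.prod_eq_one fun i _ => ?_
  split_ifs <;> simp

lemma pauliPhase_mul (s t : PauliIndex N) :
    pauliPhase s * pauliPhase t * bitSign (s.2 ⬝ᵥ t.1) =
      bitSign (quatForm s t) * pauliPhase (s + t) := by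
  have quaternion (a b c d : ZMod 2) :
      (if a = b then (1 : ℂ) else Complex.I) * (if c = d then 1 else Complex.I) *
          bitSign (b * c) =
        bitSign (a * c) * bitSign (b * d) * bitSign (a * d) *
          (if a + c = b + d then 1 else Complex.I) := by
    have h : (1 + 1 : ZMod 2) = 0 := rfl
    rcases zmod_two_eq_zero_or_eq_one a with rfl | rfl <;>
      rcases zmod_two_eq_zero_or_eq_one b with rfl | rfl <;>
      rcases zmod_two_eq_zero_or_eq_one c with rfl | rfl <;>
      rcases zmod_two_eq_zero_or_eq_one d with rfl | rfl <;>
      simp [bitSign_of_ne_zero, h]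
  simp only [pauliPhase, quatForm, dotProduct, AddChar.map_add_eq_mul, bitSign_sum,
    ← Finset.prod_mul_distrib]
  exact Finset.prod_congr rfl fun i _ => quaternion (s.1 i) (s.2 i) (t.1 i) (t.2 i)

/-- The Pauli error with index `t`, rescaled to a tensor product of quaternion units. -/
def quatPauli (t : PauliIndex N) : QubitSpace N →ₗ[ℂ] QubitSpace N := pauliPhase t • pauliLin t

lemma quatPauli_zero : quatPauli (0 : PauliIndex N) = 1 := by
  ext1 ψ
  simp [quatPauli, pauliPhase, pauliLin_apply, pauli_zero]

lemma quatPauli_mul (s t : PauliIndex N) :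
    quatPauli s * quatPauli t = bitSign (quatForm s t) • quatPauli (s + t) := by
  rw [quatPauli, quatPauli, smul_mul_smul_comm, pauliLin_mul, smul_smul, pauliPhase_mul, mul_smul,
    quatPauli]

lemma quatPauli_pauli (t e : PauliIndex N) (ψ : QubitSpace N) :
    quatPauli t (pauli e.1 e.2 ψ) = bitSign (sympForm t e) • pauli e.1 e.2 (quatPauli t ψ) := by
  have h : quatPauli t * pauliLin e = bitSign (sympForm t e) • (pauliLin e * quatPauli t) := by
    rw [quatPauli, smul_mul_assoc, pauliLin_mul_comm, smul_comm, mul_smul_comm]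
  exact LinearMap.congr_fun h ψ

lemma inner_quatPauli_quatPauli (t : PauliIndex N) (φ ψ : QubitSpace N) :
    inner ℂ (quatPauli t φ) (quatPauli t ψ) = inner ℂ φ ψ := by
  rw [quatPauli, LinearMap.smul_apply, LinearMap.smul_apply, inner_smul_left, inner_smul_right,
    ← mul_assoc, star_pauliPhase_mul_self, one_mul]
  exact inner_pauli_pauli t.1 t.2 φ ψ

/-- The stabilizer code of a group `T` of Pauli indices: the joint fixed space of the rescaled
errors `quatPauli t` with `t ∈ T`. It is of interest if `quatForm` vanishes on `T`, so that these
operators form a group. -/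
def stabilizerCode (T : AddSubgroup (PauliIndex N)) : Submodule ℂ (QubitSpace N) :=
  ⨅ t ∈ T, LinearMap.eqLocus (quatPauli t) LinearMap.id

lemma mem_stabilizerCode {T : AddSubgroup (PauliIndex N)} {ψ : QubitSpace N} :
    ψ ∈ stabilizerCode T ↔ ∀ t ∈ T, quatPauli t ψ = ψ := by
  simp [stabilizerCode]

/-- The representation of a group `T` of Pauli indices by the rescaled errors `quatPauli`. -/
def quatPauliRep (T : AddSubgroup (PauliIndex N)) (hT : ∀ s ∈ T, ∀ t ∈ T, quatForm s t = 0) :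
    Representation ℂ (Multiplicative T) (QubitSpace N) where
  toFun t := quatPauli (t.toAdd : PauliIndex N)
  map_one' := quatPauli_zero
  map_mul' s t := by
    rw [quatPauli_mul, hT _ s.toAdd.2 _ t.toAdd.2, AddChar.map_zero_eq_one, one_smul]
    rfl

lemma invariants_quatPauliRep (T : AddSubgroup (PauliIndex N))
    (hT : ∀ s ∈ T, ∀ t ∈ T, quatForm s t = 0) :
    (quatPauliRep T hT).invariants = stabilizerCode T := by
  ext ψ
  exact (Multiplicative.forall.trans Subtype.forall).trans mem_stabilizerCode.symm

lemma natCard_mul_finrank_stabilizerCode (T : AddSubgroup (PauliIndex N))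
    (hT : ∀ s ∈ T, ∀ t ∈ T, quatForm s t = 0) :
    Nat.card T * Module.finrank ℂ (stabilizerCode T) = 2 ^ N := by
  classical
  have hcard : (Nat.card (Multiplicative T) : ℂ) ≠ 0 := Nat.cast_ne_zero.mpr Nat.card_pos.ne'
  let _ := Fintype.ofFinite (Multiplicative T)
  let _ := invertibleOfNonzero hcard
  have hchar (t : Multiplicative T) (ht : t ≠ 1) : (quatPauliRep T hT).character t = 0 := by
    have ht₀ : (t.toAdd : PauliIndex N) ≠ 0 := fun h => ht (Subtype.ext h)
    change LinearMap.trace ℂ _ (pauliPhase _ • pauliLin _) = 0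
    rw [map_smul, trace_pauliLin ht₀, smul_zero]
  have h := (quatPauliRep T hT).card_inv_mul_sum_char_eq_finrank
  rw [Fintype.sum_eq_single 1 hchar, Representation.char_one, finrank_euclideanSpace,
    inv_mul_eq_iff_eq_mul₀ hcard, invariants_quatPauliRep, Fintype.card_pi_const, ZMod.card] at h
  exact_mod_cast h.symm

lemma inner_pauli_eq_zero_of_mem_stabilizerCode {T : AddSubgroup (PauliIndex N)}
    {e t : PauliIndex N} (ht : t ∈ T) (het : sympForm t e ≠ 0) {φ ψ : QubitSpace N}
    (hφ : φ ∈ stabilizerCode T) (hψ : ψ ∈ stabilizerCode T) :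
    inner ℂ φ (pauli e.1 e.2 ψ) = 0 := by
  rw [mem_stabilizerCode] at hφ hψ
  have h : inner ℂ φ (pauli e.1 e.2 ψ) = -inner ℂ φ (pauli e.1 e.2 ψ) :=
    calc inner ℂ φ (pauli e.1 e.2 ψ)
        = inner ℂ (quatPauli t φ) (quatPauli t (pauli e.1 e.2 ψ)) :=
          (inner_quatPauli_quatPauli t _ _).symm
      _ = -inner ℂ φ (pauli e.1 e.2 ψ) := by
          rw [quatPauli_pauli, bitSign_of_ne_zero het, hφ t ht, hψ t ht, neg_one_smul,
            inner_neg_right]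
  exact self_eq_neg.mp h

lemma pauli_mem_stabilizerCode {T : AddSubgroup (PauliIndex N)} {e : PauliIndex N}
    (he : ∀ t ∈ T, sympForm t e = 0) {ψ : QubitSpace N} (hψ : ψ ∈ stabilizerCode T) :
    pauli e.1 e.2 ψ ∈ stabilizerCode T := by
  rw [mem_stabilizerCode] at hψ ⊢
  intro t ht
  rw [quatPauli_pauli, he t ht, AddChar.map_zero_eq_one, one_smul, hψ t ht]

lemma pauliWeight_pos_iff {a b : Fin N → ZMod 2} :
    0 < pauliWeight a b ↔ ((a, b) : PauliIndex N) ≠ 0 := by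
  simp only [pauliWeight, Finset.card_pos, Finset.filter_nonempty_iff, Finset.mem_univ, true_and,
    ne_eq, Prod.mk_eq_zero, funext_iff, Pi.zero_apply, ← not_and_or, ← not_forall, forall_and]

/-- The weights of the nontrivial Pauli errors that commute with all errors in `T`. -/
def commutantWeights (T : AddSubgroup (PauliIndex N)) : Set ℕ :=
  {w | ∃ e : PauliIndex N, e ≠ 0 ∧ (∀ t ∈ T, sympForm t e = 0) ∧ pauliWeight e.1 e.2 = w}

lemma isPureTo_stabilizerCode {T : AddSubgroup (PauliIndex N)} {d : ℕ}
    (hd : d ∈ lowerBounds (commutantWeights T)) : IsPureTo (stabilizerCode T) d := by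
  intro a b hpos hlt φ hφ ψ hψ
  obtain ⟨t, ht, het⟩ : ∃ t ∈ T, sympForm t (a, b) ≠ 0 := by
    by_contra! h
    exact (hd ⟨(a, b), pauliWeight_pos_iff.mp hpos, h, rfl⟩).not_gt hlt
  exact inner_pauli_eq_zero_of_mem_stabilizerCode ht het hφ hψ

lemma not_isPureTo_stabilizerCode {T : AddSubgroup (PauliIndex N)} (hT : stabilizerCode T ≠ ⊥)
    {w : ℕ} (hw : w ∈ commutantWeights T) : ¬ IsPureTo (stabilizerCode T) (w + 1) := by
  obtain ⟨e, he, hcomm, rfl⟩ := hw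
  obtain ⟨ψ, hψ, hψ₀⟩ := Submodule.exists_mem_ne_zero_of_ne_bot hT
  intro hpure
  have h := hpure e.1 e.2 (pauliWeight_pos_iff.mpr he) (Nat.lt_succ_self _) _
    (pauli_mem_stabilizerCode hcomm hψ) ψ hψ
  rw [inner_pauli_pauli] at h
  exact hψ₀ (inner_self_eq_zero.mp h)

lemma IsPureTo.detects {Q : Submodule ℂ (QubitSpace N)} {d : ℕ} (hQ : IsPureTo Q d)
    {a b : Fin N → ZMod 2} (hab : pauliWeight a b < d) : Detects Q a b := by
  obtain hpos | hzero := (Nat.zero_le (pauliWeight a b)).lt_or_eq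
  · exact ⟨0, fun φ hφ ψ hψ => by rw [hQ a b hpos hab φ hφ ψ hψ, zero_mul]⟩
  · obtain ⟨rfl, rfl⟩ : a = 0 ∧ b = 0 := by
      rw [← Prod.mk_eq_zero]
      exact not_not.mp (mt pauliWeight_pos_iff.mpr hzero.not_lt)
    exact ⟨1, fun φ _ ψ _ => by rw [pauli_zero, one_mul]⟩

theorem isPureQuantumCode_stabilizerCode {T : AddSubgroup (PauliIndex N)}
    (hT : ∀ s ∈ T, ∀ t ∈ T, quatForm s t = 0) {k r d : ℕ} (hr : Nat.card T = 2 ^ r)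
    (hk : k + r = N) (hd : IsLeast (commutantWeights T) d) :
    IsPureQuantumCode (stabilizerCode T) k d := by
  have hfinrank : Module.finrank ℂ (stabilizerCode T) = 2 ^ k := by
    have h := natCard_mul_finrank_stabilizerCode T hT
    have hN : 2 ^ N = 2 ^ r * 2 ^ k := by rw [← pow_add, add_comm, hk]
    rw [hr, hN] at h
    exact Nat.eq_of_mul_eq_mul_left (by positivity) h
  have hbot : stabilizerCode T ≠ ⊥ := fun h => by
    rw [h, finrank_bot] at hfinrank
    exact pow_ne_zero k two_ne_zero hfinrank.symm
  have hpure := isPureTo_stabilizerCode hd.2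
  exact ⟨hfinrank, fun _ _ => hpure.detects, hpure, not_isPureTo_stabilizerCode hbot hd.1⟩

end Pauli

section FieldWithFourElements

lemma charP_two_of_card_eq_four {F : Type*} [Field F] [Fintype F] (hF : Fintype.card F = 4) :
    CharP F 2 :=
  charP_of_card_eq_prime_pow (f := 2) (p := 2) hF

variable {F : Type*} [Field F]

lemma pow_four_eq_self [Fintype F] (hF : Fintype.card F = 4) (x : F) : x ^ 4 = x := by
  rw [← hF, FiniteField.pow_card]

lemma exists_sq_add_self_add_one_eq_zero [Fintype F] (hF : Fintype.card F = 4) :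
    ∃ ω : F, ω ^ 2 + ω + 1 = 0 := by
  classical
  have hcard : ({0, 1} : Finset F).card < (Finset.univ : Finset F).card := by
    rw [Finset.card_univ, hF]
    exact Finset.card_le_two.trans_lt (by norm_num)
  obtain ⟨ω, -, hω⟩ := Finset.exists_mem_notMem_of_card_lt_card hcard
  simp only [Finset.mem_insert, Finset.mem_singleton, not_or] at hω
  have hfactor : ω * (ω - 1) * (ω ^ 2 + ω + 1) = 0 := by linear_combination pow_four_eq_self hF ω
  exact ⟨ω, (mul_eq_zero.mp hfactor).resolve_left
    (mul_ne_zero hω.1 (sub_ne_zero.mpr hω.2))⟩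

variable [CharP F 2]

lemma frobenius_two_involutive [Fintype F] (hF : Fintype.card F = 4) :
    Function.Involutive (frobenius F 2) := fun x => by
  rw [frobenius_def, frobenius_def, ← pow_mul, pow_four_eq_self hF]

variable (F) in
/-- The inclusion of the prime field into a field of characteristic two. -/
abbrev bitInclusion : ZMod 2 →+* F := ZMod.castHom (dvd_refl 2) F

/-- Coordinates on the field with four elements with respect to the basis `ω`, `ω ^ 2` over the
prime field, where `ω` is a primitive cube root of unity. In this basis the Hermitian form
consists of the forms `quatForm` and `sympForm`. -/
def quadCoord (ω : F) : ZMod 2 × ZMod 2 →+ F where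
  toFun s := bitInclusion F s.1 * ω + bitInclusion F s.2 * ω ^ 2
  map_zero' := by simp
  map_add' s t := by simp only [Prod.fst_add, Prod.snd_add, map_add]; ring

lemma quadCoord_apply (ω : F) (s : ZMod 2 × ZMod 2) :
    quadCoord ω s = bitInclusion F s.1 * ω + bitInclusion F s.2 * ω ^ 2 := rfl

/-- The word over the field with four elements that encodes a Pauli error: its `j`th letter is
determined by the action of the error on the qubit `σ j`. -/
def pauliWord (ω : F) {I : Type*} {N : ℕ} (σ : I ≃ Fin N) : PauliIndex N →+ (I → F) where
  toFun s j := quadCoord ω (s.1 (σ j), s.2 (σ j))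
  map_zero' := funext fun _ => map_zero (quadCoord ω)
  map_add' s t := funext fun j =>
    map_add (quadCoord ω) (s.1 (σ j), s.2 (σ j)) (t.1 (σ j), t.2 (σ j))

variable {I : Type*} {N : ℕ}

lemma pauliWord_apply (ω : F) (σ : I ≃ Fin N) (s : PauliIndex N) (j : I) :
    pauliWord ω σ s j = quadCoord ω (s.1 (σ j), s.2 (σ j)) := rfl

/-- The Pauli errors that are encoded by the words of a code. -/
def pauliGroup (ω : F) (σ : I ≃ Fin N) (S : Submodule F (I → F)) :
    AddSubgroup (PauliIndex N) :=
  S.toAddSubgroup.comap (pauliWord ω σ)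

section PrimitiveCubeRoot

variable {ω : F} (hω : ω ^ 2 + ω + 1 = 0) (σ : I ≃ Fin N)

include hω

lemma bitInclusion_add_mul_eq_zero {x y : ZMod 2}
    (h : bitInclusion F x + bitInclusion F y * ω = 0) : x = 0 ∧ y = 0 := by
  have hω₁ : 1 + ω ≠ 0 := fun h₁ => one_ne_zero (α := F) (by linear_combination hω - ω * h₁)
  rcases zmod_two_eq_zero_or_eq_one x with rfl | rfl <;>
    rcases zmod_two_eq_zero_or_eq_one y with rfl | rfl <;> simp_all

lemma quadCoord_injective : Function.Injective (quadCoord ω) := by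
  rw [injective_iff_map_eq_zero]
  intro s hs
  have hω₀ : ω ≠ 0 := by
    rintro rfl
    simp at hω
  have h : ω * (bitInclusion F s.1 + bitInclusion F s.2 * ω) = 0 := by
    rw [← hs, quadCoord_apply]
    ring
  exact Prod.mk_eq_zero.mpr
    (bitInclusion_add_mul_eq_zero hω ((mul_eq_zero.mp h).resolve_left hω₀))

lemma quadCoord_mul_frobenius_quadCoord (s t : ZMod 2 × ZMod 2) :
    quadCoord ω s * frobenius F 2 (quadCoord ω t) =
      bitInclusion F (s.1 * t.1 + s.2 * t.2 + s.1 * t.2) +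
        bitInclusion F (s.1 * t.2 + s.2 * t.1) * ω := by
  have hcube : ω ^ 3 = 1 := by linear_combination (ω - 1) * hω
  have hfour : (ω ^ 2) ^ 2 = ω := by linear_combination ω * hcube
  have htwo : (2 : F) = 0 := CharTwo.two_eq_zero
  have hfrob (x : ZMod 2) : frobenius F 2 (bitInclusion F x) = bitInclusion F x := by
    rw [← RingHom.comp_apply]
    exact RingHom.congr_fun (Subsingleton.elim _ _) x
  simp only [quadCoord_apply, map_add, map_mul, hfrob, frobenius_def, hfour]
  generalize bitInclusion F s.1 = a, bitInclusion F s.2 = b, bitInclusion F t.1 = c,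
    bitInclusion F t.2 = d
  linear_combination (a * c + b * d) * hcube + a * d * hω + b * c * ω * hcube -
    a * d * (ω + 1) * htwo

lemma pauliWord_injective : Function.Injective (pauliWord ω σ) := by
  intro s t h
  have hcoord (l : Fin N) : (s.1 l, s.2 l) = (t.1 l, t.2 l) := by
    have hl := congrFun h (σ.symm l)
    rw [pauliWord_apply, pauliWord_apply, σ.apply_symm_apply] at hl
    exact quadCoord_injective hω hl
  exact Prod.ext (funext fun l => congrArg Prod.fst (hcoord l))
    (funext fun l => congrArg Prod.snd (hcoord l))

lemma pauliWord_surjective [Fintype F] (hF : Fintype.card F = 4) :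
    Function.Surjective (pauliWord ω σ) := by
  have hquad : Function.Surjective (quadCoord ω) :=
    ((Fintype.bijective_iff_injective_and_card _).mpr
      ⟨quadCoord_injective hω, hF.symm⟩).surjective
  intro w
  choose s hs using fun l => hquad (w (σ.symm l))
  refine ⟨(fun l => (s l).1, fun l => (s l).2), funext fun j => ?_⟩
  rw [pauliWord_apply, Prod.mk.eta, hs, σ.symm_apply_apply]

lemma hammingNorm_pauliWord [Fintype I] [DecidableEq F] (s : PauliIndex N) :
    hammingNorm (pauliWord ω σ s) = pauliWeight s.1 s.2 := by
  refine Finset.card_equiv σ fun j => ?_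
  simp only [Finset.mem_filter, Finset.mem_univ, true_and, pauliWord_apply, ne_eq,
    map_eq_zero_iff _ (quadCoord_injective hω), Prod.mk_eq_zero, not_and_or]

lemma hermForm_pauliWord [Fintype I] (s t : PauliIndex N) :
    hermForm (frobenius F 2) I (pauliWord ω σ s) (pauliWord ω σ t) =
      bitInclusion F (quatForm s t) + bitInclusion F (sympForm s t) * ω := by
  simp only [hermForm_apply, pauliWord_apply, quadCoord_mul_frobenius_quadCoord hω, quatForm,
    sympForm, dotProduct, ← Finset.sum_add_distrib, map_sum, Finset.sum_mul]
  exact Equiv.sum_comp σ fun l =>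
    bitInclusion F (s.1 l * t.1 l + s.2 l * t.2 l + s.1 l * t.2 l) +
      bitInclusion F (s.1 l * t.2 l + s.2 l * t.1 l) * ω

lemma natCard_pauliGroup [Fintype F] (hF : Fintype.card F = 4) [Finite I]
    (S : Submodule F (I → F)) :
    Nat.card (pauliGroup ω σ S) = 2 ^ (2 * Module.finrank F S) := by
  have hbij : Function.Bijective (pauliWord ω σ) :=
    ⟨pauliWord_injective hω σ, pauliWord_surjective hω σ hF⟩
  calc Nat.card (pauliGroup ω σ S) = Nat.card S :=
        Nat.card_congr ((Equiv.ofBijective _ hbij).subtypeEquiv fun _ => Iff.rfl)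
    _ = 2 ^ (2 * Module.finrank F S) := by
        rw [Module.natCard_eq_pow_finrank (K := F), Nat.card_eq_fintype_card, hF, pow_mul]
        norm_num

variable [Fintype I]

lemma quatForm_eq_zero_of_mem_pauliGroup {S : Submodule F (I → F)}
    (hS : S ≤ hermDual (frobenius F 2) S) {s t : PauliIndex N} (hs : s ∈ pauliGroup ω σ S)
    (ht : t ∈ pauliGroup ω σ S) : quatForm s t = 0 :=
  (bitInclusion_add_mul_eq_zero hω
    ((hermForm_pauliWord hω σ s t).symm.trans (mem_hermDual.mp (hS ht) _ hs))).1

-- Multiplying the code by `ω` recovers the Hermitian form from its `ω`-component `sympForm`.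
lemma forall_sympForm_eq_zero_iff [Fintype F] (hF : Fintype.card F = 4) {S : Submodule F (I → F)}
    {e : PauliIndex N} :
    (∀ t ∈ pauliGroup ω σ S, sympForm t e = 0) ↔
      pauliWord ω σ e ∈ hermDual (frobenius F 2) S := by
  refine ⟨fun h => mem_hermDual.mpr fun w hw => ?_, fun h t ht => (bitInclusion_add_mul_eq_zero hω
    ((hermForm_pauliWord hω σ t e).symm.trans (mem_hermDual.mp h _ ht))).2⟩
  have form_eq {w : I → F} (hw : w ∈ S) : ∃ x : ZMod 2,
      hermForm (frobenius F 2) I w (pauliWord ω σ e) = bitInclusion F x := by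
    obtain ⟨t, rfl⟩ := pauliWord_surjective hω σ hF w
    exact ⟨quatForm t e, by rw [hermForm_pauliWord hω, h t hw, map_zero, zero_mul, add_zero]⟩
  obtain ⟨x, hx⟩ := form_eq hw
  obtain ⟨y, hy⟩ := form_eq (S.smul_mem ω hw)
  rw [map_smul, LinearMap.smul_apply, hx, smul_eq_mul] at hy
  rw [hx, (bitInclusion_add_mul_eq_zero hω (x := -y) (y := x)
    (by rw [map_neg]; linear_combination hy)).2, map_zero]

lemma commutantWeights_pauliGroup [Fintype F] [DecidableEq F] (hF : Fintype.card F = 4)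
    (S : Submodule F (I → F)) :
    commutantWeights (pauliGroup ω σ S) =
      {w | ∃ c ∈ hermDual (frobenius F 2) S, c ≠ 0 ∧ hammingNorm c = w} := by
  ext w
  simp only [commutantWeights, Set.mem_ofPred_eq, (pauliWord_surjective hω σ hF).exists,
    forall_sympForm_eq_zero_iff hω σ hF, hammingNorm_pauliWord hω, ne_eq,
    map_eq_zero_iff _ (pauliWord_injective hω σ), and_left_comm]

end PrimitiveCubeRoot

theorem exists_isPureQuantumCode_of_le_hermDual [Fintype I] [Fintype F] [DecidableEq F]
    (hF : Fintype.card F = 4) (hI : Fintype.card I = N) {S : Submodule F (I → F)}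
    (hS : S ≤ hermDual (frobenius F 2) S) {k d : ℕ} (hk : k + 2 * Module.finrank F S = N)
    (hd : IsLeast {w | ∃ c ∈ hermDual (frobenius F 2) S, c ≠ 0 ∧ hammingNorm c = w} d) :
    ∃ Q : Submodule ℂ (QubitSpace N), IsPureQuantumCode Q k d := by
  obtain ⟨ω, hω⟩ := exists_sq_add_self_add_one_eq_zero hF
  obtain ⟨σ⟩ : Nonempty (I ≃ Fin N) := ⟨Fintype.equivFinOfCardEq hI⟩
  rw [← commutantWeights_pauliGroup hω σ hF] at hd
  exact ⟨_, isPureQuantumCode_stabilizerCode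
    (fun _ hs _ ht => quatForm_eq_zero_of_mem_pauliGroup hω σ hS hs ht)
    (natCard_pauliGroup hω σ hF S) hk hd⟩

end FieldWithFourElements

theorem theorem3 {F : Type*} [Field F] [Fintype F] [DecidableEq F] (hF : Fintype.card F = 4)
    (n : ℕ) (hn : 0 < n) (g₁ g₂ ν : F[X])
    (hg₁ : g₁ ∣ X ^ n - 1) (hg₂ : g₂ ∣ X ^ n - 1) (hν : ν.degree < n)
    (hdim : IsCoprime (ν - 1) (X ^ n - 1) ∨
      (Module.finrank F (qcCode n g₁ g₂ ν) + g₁.natDegree + g₂.natDegree = 2 * n ∧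
        Module.finrank F (qcCode n (hermPerp n g₁) (hermPerp n g₂) (-hermBar n ν)) =
          g₁.natDegree + g₂.natDegree))
    (h₁ : g₁ ∣ (ν * hermBar n ν + 1) * hermPerp n g₁)
    (h₂ : g₂ ∣ (ν * hermBar n ν + 1) * hermPerp n g₂)
    (h₁₂ : g₂ ∣ (ν + hermBar n ν) * hermPerp n g₁) :
    2 * g₁.natDegree + 2 * g₂.natDegree ≤ 2 * n ∧
      ∃ d : ℕ, IsLeast {w : ℕ | ∃ c ∈ qcCode n g₁ g₂ ν, c ≠ 0 ∧ hammingNorm c = w} d ∧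
        ∃ Q : Submodule ℂ (QubitSpace (2 * n)),
          IsPureQuantumCode Q (2 * n - 2 * g₁.natDegree - 2 * g₂.natDegree) d := by
  have := charP_two_of_card_eq_four hF
  have : NeZero n := ⟨hn.ne'⟩
  have hfrob := frobenius_two_involutive hF
  have hcard : Fintype.card (Fin n ⊕ Fin n) = 2 * n := by
    rw [Fintype.card_sum, Fintype.card_fin, two_mul]
  have hself := qcCode_le_hermDual_self hfrob hg₁ hg₂ hν h₁ h₂ h₁₂
  obtain ⟨hdual, hrank⟩ := hermDual_qcCode_eq_and_finrank_eq hfrob hg₁ hg₂ hν hdim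
  have hsum := finrank_add_finrank_hermDual hfrob.bijective
    (qcCode n (hermPerp n g₁) (hermPerp n g₂) (-hermBar n ν))
  have hle := Submodule.finrank_mono hself
  rw [hdual] at hsum hle
  have hC : qcCode n g₁ g₂ ν ≠ ⊥ := fun h => by
    rw [h, finrank_bot] at hsum hle
    omega
  obtain ⟨d, hd⟩ := exists_isLeast_hammingNorm hC
  exact ⟨by omega, d, hd, exists_isPureQuantumCode_of_le_hermDual hF hcard hself (by omega)
    (by rwa [hdual])⟩
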